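/- Let $\mathbb K$ be a field of characteristic zero, $V$ a $\mathbb K$-vector space of finite dimension $r\ge 1$, $U=V^*$, and $X=(x_1,\dots,x_N)$ a finite sequence of vectors that spans $U$. A flat of $X$ is a subsequence $C$ that contains every $x_i$ lying in the linear span of $C$; a hyperplane is a flat of rank $r-1$. Let $\mathcal L(X)$ be the lattice of flats and $\mathcal H$ the set of hyperplanes of $X$. For every $H\in\mathcal H$ let $D_H\in V$ be a defining normal, i.e. $H=\{x\in X: x(D_H)=0\}$. Let $\mathfrak H\in\{0,1\}^{\mathcal H\times N}$ be the matrix whose $(H,i)$ entry is $1$ if and only if $x_i\notin H$, and let $\mathbf e=(1,\dots,1)\in\mathbb N^{\mathcal H}$. The group $G=\{\lambda\in\mathbb K^{\mathcal H}:\sum_H\lambda_H D_H=0\}$ acts on $\mathbb K[s_H,t_H : H\in\mathcal H]$ by $s_H\mapsto s_H$, $t_H\mapsto t_H+\lambda_H s_H$. Let $R^G$ be its ring of invariants (the Cox--Nagata ring). For $d\in\mathbb Z$ and $u\in\mathbb Z^{\mathcal H}$ let $R^G_{(d,u)}$ be its component of degree $(d,u)$, where $\deg s_H=(0,e_H)$,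 $\deg t_H=(1,e_H)$ and $(e_H)_{H\in\mathcal H}$ is the standard basis of $\mathbb Z^{\mathcal H}$. Let $\mathbf a\in\mathbb N^N$ (with $0\in\mathbb N$) and $\mathbf b\in\{0,1\}^{\mathcal H}$. Let $X(\mathbf a)$ be the sequence obtained from $X$ by replacing each $x_i$ by $a_i$ copies of itself. Let $J_{\mathbf b}$ be the upper set $\{C\in\mathcal L(X): b_H=1 \text{ for all hyperplanes } H\supseteq C\}$; a subsequence $A$ of $X(\mathbf a)$ is said to have closure in $J_{\mathbf b}$ if the flat of $X$ spanned by the vectors in $A$ belongs to $J_{\mathbf b}$. For $Y\subseteq X(\mathbf a)$ put $p_Y=\prod_{x\in Y}x\in\mathrm{Sym}(U)$, and let $$\mathcal P(X(\mathbf a),0,J_{\mathbf b})=\mathrm{span}\{p_Y : Y\subseteq X(\mathbf a),\ X(\mathbf a)\setminus Y\text{ has closure in }J_{\mathbf b}\}\subseteq\mathrm{Sym}(U).$$ Then for all $d\in\mathbb N$ there is a natural isomorphism of $\mathbb K$-vector spaces $$R^G_{(d,\ \mathfrak H\mathbf a-\mathbf e+\mathbf b)}\;\cong\;\mathcal P(X(\mathbf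 a),0,J_{\mathbf b})_d$$ onto the homogeneous component of degree $d$. Natural means that $g(s,t)$ corresponds to the $F\in\mathrm{Sym}(U)$, viewed as a polynomial function on $V$, with $g(1,t)=F\bigl(\sum_H t_H D_H\bigr)$. -/

import Mathlib

open scoped Matrix

noncomputable section

namespace Zonotopal

/-! ### The linear matroid of a finite family of vectors and its lattice of flats -/

section Matroid

variable (K : Type*) {U ι : Type*} [Field K] [AddCommGroup U] [Module K U]

/-- The rank of a subfamily `Y` of `X`. -/
def rk (X : ι → U) (Y : Set ι) : ℕ := Module.finrank K (Submodule.span K (X '' Y))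

/-- The closure of `Y` in `X`: all indices of vectors whose addition to `Y` does not enlarge
the linear span (equivalently, does not change the rank). -/
def clos (X : ι → U) (Y : Set ι) : Set ι := {i | X i ∈ Submodule.span K (X '' Y)}

theorem subset_clos (X : ι → U) (Y : Set ι) : Y ⊆ clos K X Y :=
  fun i hi => Submodule.subset_span ⟨i, hi, rfl⟩

theorem clos_mono (X : ι → U) {Y Z : Set ι} (h : Y ⊆ Z) : clos K X Y ⊆ clos K X Z :=
  fun _ hi => Submodule.span_mono (Set.image_mono h) hi

theorem clos_clos (X : ι → U) (Y : Set ι) : clos K X (clos K X Y) = clos K X Y := by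
  refine Set.Subset.antisymm (fun i hi => ?_) (subset_clos K X _)
  have h : Submodule.span K (X '' clos K X Y) ≤ Submodule.span K (X '' Y) := by
    rw [Submodule.span_le]
    rintro _ ⟨j, hj, rfl⟩
    exact hj
  exact h hi

/-- The lattice of flats of `X`, ordered by inclusion. -/
abbrev Flat (X : ι → U) : Type _ := {C : Set ι // clos K X C = C}

/-- The closure of `Y` in `X` as a flat. -/
def closFlat (X : ι → U) (Y : Set ι) : Flat K X := ⟨clos K X Y, clos_clos K X Y⟩

/-- The hyperplanes of `X`: the flats of rank `r - 1`, where `r = dim U`. -/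
abbrev Hyperplane (X : ι → U) : Type _ :=
  {H : Flat K X // rk K X H.1 + 1 = Module.finrank K U}

instance [Finite ι] (X : ι → U) : Fintype (Hyperplane K X) := Fintype.ofFinite _

/-- The non-containment hyperplane-vector matrix: the entry at `(H, x)` is `1` if `H` does
not contain `x`, and `0` otherwise. -/
def nonContainment (X : ι → U) : Matrix (Hyperplane K X) ι ℤ := by
  classical exact fun H i => if i ∈ H.1.1 then 0 else 1

/-- The upper set `J_b` of all flats `C` such that `b H = 1` for every hyperplane `H ⊇ C`. -/
def upperSetOf (X : ι → U) (b : Hyperplane K X → Fin 2) : UpperSet (Flat K X) where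
  carrier := {C | ∀ H : Hyperplane K X, C ≤ H.1 → b H = 1}
  upper' := fun _ _ hle hC H hH => hC H (hle.trans hH)

/-- The sequence `X(a)`: each `X i` is replaced by `a i` copies of itself. -/
def replicate (X : ι → U) (a : ι → ℕ) : (Σ i, Fin (a i)) → U := fun p => X p.1

/-- An upper set `J` of flats of `X`, regarded as an upper set of flats of `X(a)`: a flat of
`X(a)` belongs to it if the flat of `X` spanned by the vectors in it belongs to `J`. (If all
`a i ≥ 1`, then this is the identification of the two lattices of flats.) -/
def upperSetReplicate (X : ι → U) (a : ι → ℕ) (J : UpperSet (Flat K X)) :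
    UpperSet (Flat K (replicate X a)) where
  carrier := {C | closFlat K X (Sigma.fst '' C.1) ∈ J}
  upper' := fun _ _ hle hC => J.upper (clos_mono K X (Set.image_mono hle)) hC

/-- The space `P(X,0,J)`: the span of the products `p_Y = ∏_{x ∈ Y} x` in `Sym(U)`, where `Y`
runs over the subsequences of `X` such that the closure of `X ∖ Y` belongs to `J`. -/
def pSpaceZero (X : ι → U) (J : UpperSet (Flat K X)) : Submodule K (SymmetricAlgebra K U) :=
  Submodule.span K {p | ∃ Y : Finset ι, closFlat K X ((Y : Set ι)ᶜ) ∈ J ∧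
    p = ∏ i ∈ Y, SymmetricAlgebra.ι K U (X i)}

/-- The homogeneous component of degree `d` of `Sym(U)`. -/
def symDegree (U : Type*) [AddCommGroup U] [Module K U] (d : ℕ) :
    Submodule K (SymmetricAlgebra K U) :=
  LinearMap.range (SymmetricAlgebra.ι K U) ^ d

/-- The homogeneous component `P(X,0,J)_d`. -/
def pSpaceZeroDegree (X : ι → U) (J : UpperSet (Flat K X)) (d : ℕ) :
    Submodule K (SymmetricAlgebra K U) :=
  pSpaceZero K X J ⊓ symDegree K U d

end Matroid

/-! ### Cox-Nagata rings -/

section CoxNagata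

variable (K : Type*) {V σ : Type*} [Field K] [AddCommGroup V] [Module K V] [Fintype σ]

/-- The group `G` acting on `K[s, t]`: the additive group of all linear relations among the
vectors `D i`. -/
def relations (D : σ → V) : Submodule K (σ → K) :=
  LinearMap.ker (Fintype.linearCombination K D)

/-- The polynomial ring `K[s, t]`; `Sum.inl i` is the index of `s_i` and `Sum.inr i` that
of `t_i`. -/
abbrev STRing (σ : Type*) : Type _ := MvPolynomial (σ ⊕ σ) K

/-- The Nagata action of `l ∈ K^σ` on `K[s, t]`: `s_i ↦ s_i` and `t_i ↦ t_i + l_i s_i`. -/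
def nagataAction (l : σ → K) : STRing K σ →ₐ[K] STRing K σ :=
  MvPolynomial.aeval (Sum.elim (fun i => MvPolynomial.X (Sum.inl i))
    (fun i => MvPolynomial.X (Sum.inr i) +
      MvPolynomial.C (l i) * MvPolynomial.X (Sum.inl i)))

/-- The Cox-Nagata ring `R^G` of the vectors `D i`: the polynomials invariant under the Nagata
action of `G`. -/
def coxNagata (D : σ → V) : Subalgebra K (STRing K σ) :=
  ⨅ l ∈ relations K D, AlgHom.equalizer (nagataAction K l) (AlgHom.id K (STRing K σ))

/-- The multigrading of `K[s, t]` by `ℤ × ℤ^σ`: `s_i` has degree `(0, e_i)` and `t_i` has degree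
`(1, e_i)`. -/
def stWeight (σ : Type*) : σ ⊕ σ → ℤ × (σ → ℤ) := by
  classical exact Sum.elim (fun i => (0, Pi.single i 1)) (fun i => (1, Pi.single i 1))

/-- The homogeneous component of multidegree `(d, u)` of the Cox-Nagata ring. -/
def coxNagataDegree (D : σ → V) (d : ℤ) (u : σ → ℤ) : Submodule K (STRing K σ) :=
  Subalgebra.toSubmodule (coxNagata K D) ⊓
    MvPolynomial.weightedHomogeneousSubmodule K (stWeight σ) (d, u)

/-- The substitution `g(s, t) ↦ g(1, t)`. -/
def setSOne (σ : Type*) : STRing K σ →ₐ[K] MvPolynomial σ K :=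
  MvPolynomial.aeval (Sum.elim (fun _ => 1) MvPolynomial.X)

/-- The substitution `F ↦ F(∑ i, t_i D_i)`, for `F ∈ Sym(V^*)` viewed as a polynomial function
on `V`: the algebra homomorphism that maps `u ∈ V^*` to `∑ i, u(D_i) t_i`. -/
def pullback (D : σ → V) :
    SymmetricAlgebra K (Module.Dual K V) →ₐ[K] MvPolynomial σ K :=
  SymmetricAlgebra.lift
    (∑ i, (Module.Dual.eval K V (D i)).smulRight (MvPolynomial.X i : MvPolynomial σ K))

end CoxNagata

end Zonotopal

end

/-! Setting `s = 1` loses nothing in a fixed multidegree `(d, u)`: the image consists of the forms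
`q(t)` of degree `d` whose degree in each `t_H` is at most `u_H`. Invariance of `g` becomes
invariance of `q` under translation by the relations among the `D_H`. As the `D_H` span `V`, this
says that `q(t) = F(∑ t_H D_H)` for a unique `F` in `Sym(U)` (`exists_pullback_eq`,
`pullback_injective`). The bound on the degree in `t_H` bounds the degree of `F` along lines in
direction `D_H`: it is less than `b_H` plus the number of vectors of `X(a)` not vanishing at `D_H`.

It remains to see that these bounds cut out `P(X(a),0,J_b)`. A product `p_Y` satisfies them, because
equality of the two counts for `Y` and `X(a)` means that the complement of `Y` lies in `H`, and then
`b_H = 1`. The converse, `exists_mem_span_truncatedProducts`, is proved for all common kernels `W`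
of vectors at once. If some `x` is nonzero on `W`, then `F` is known on `W ∩ ker x` by induction,
and the products found there lift to a combination `Q` on `W`. Now `F - Q` is divisible by `x` on
`W`, and the quotient satisfies the bounds for the list without `x`. If no `x` remains, the bounds
make `F` constant or zero on `W`, because the normals in `W` span it
(`commonKernel_le_span_normals`). -/

namespace Zonotopal

open Polynomial

/-! ### Polynomial functions on `V` and their degrees along lines -/

section Evaluation

variable {K V : Type*} [Field K] [AddCommGroup V] [Module K V]

/-- The evaluation at `v : V` of an element of `Sym(V^*)`, viewed as a polynomial function. -/
noncomputable def evalAt (v : V) : SymmetricAlgebra K (Module.Dual K V) →ₐ[K] K :=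
  SymmetricAlgebra.lift (Module.Dual.eval K V v)

/-- The restriction of an element of `Sym(V^*)` to the parametrized line `t ↦ w + t D`. -/
noncomputable def lineAt (w D : V) : SymmetricAlgebra K (Module.Dual K V) →ₐ[K] K[X] :=
  SymmetricAlgebra.lift ((Module.Dual.eval K V w).smulRight (1 : K[X]) +
    (Module.Dual.eval K V D).smulRight (X : K[X]))

/-- The restriction of an element of `Sym(V^*)` to the parametrized plane
`(s, t) ↦ w + s e + t D`. -/
noncomputable def planeAt (w e D : V) : SymmetricAlgebra K (Module.Dual K V) →ₐ[K] K[X][X] :=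
  SymmetricAlgebra.lift ((Module.Dual.eval K V w).smulRight (1 : K[X][X]) +
    (Module.Dual.eval K V e).smulRight (C X : K[X][X]) +
    (Module.Dual.eval K V D).smulRight (X : K[X][X]))

@[simp]
theorem evalAt_ι (v : V) (u : Module.Dual K V) :
    evalAt v (SymmetricAlgebra.ι K _ u) = u v := by
  simp [evalAt]

theorem lineAt_ι (w D : V) (u : Module.Dual K V) :
    lineAt w D (SymmetricAlgebra.ι K _ u) = C (u w) + C (u D) * X := by
  simp [lineAt, Polynomial.smul_eq_C_mul]

theorem eval_lineAt (w D : V) (c : K) (F : SymmetricAlgebra K (Module.Dual K V)) :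
    (lineAt w D F).eval c = evalAt (w + c • D) F := by
  have : (Polynomial.aeval c).comp (lineAt w D) = evalAt (w + c • D) := by
    ext u
    simp [lineAt_ι, -X_mul_C, mul_comm c]
  rw [← this]
  simp

/-- Coefficients along a line depend polynomially on the base point, so a vanishing known for
generic base points extends to all of them. -/
theorem coeff_lineAt_add_smul (w e D : V) (s : K) (F : SymmetricAlgebra K (Module.Dual K V))
    (k : ℕ) : (lineAt (w + s • e) D F).coeff k = ((planeAt w e D F).coeff k).eval s := by
  have : (Polynomial.mapAlgHom (Polynomial.aeval s)).comp (planeAt w e D) =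
      lineAt (w + s • e) D := by
    ext1
    ext1 u
    suffices h : C (u w) + C (u e) * C s + C (u D) * X =
        lineAt (w + s • e) D (SymmetricAlgebra.ι K _ u) by
      simpa [planeAt, Algebra.smul_def] using h
    rw [lineAt_ι]
    simp [mul_comm s]
  rw [← this]
  simp [Polynomial.coeff_map]

/-- A polynomial function on `V` that vanishes everywhere is zero. -/
theorem eq_zero_of_evalAt_eq_zero [Infinite K] [FiniteDimensional K V]
    {F : SymmetricAlgebra K (Module.Dual K V)} (h : ∀ v, evalAt v F = 0) : F = 0 := by
  classical
  let B := Module.finBasis K V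
  apply (SymmetricAlgebra.equivMvPolynomial B.dualBasis).injective
  rw [map_zero]
  refine MvPolynomial.funext fun c => ?_
  have : (MvPolynomial.aeval c).comp
      (SymmetricAlgebra.equivMvPolynomial B.dualBasis).toAlgHom =
      evalAt (∑ j, c j • B j) := by
    ext1
    refine B.dualBasis.ext fun i => ?_
    have := SymmetricAlgebra.equivMvPolynomial_ι_apply B.dualBasis i
    simp_all [Finsupp.single_apply]
  have h' := DFunLike.congr_fun this F
  rw [h] at h'
  simpa [MvPolynomial.aeval_eq_eval] using h'

/-- If `x e = 1`, every polynomial function agrees modulo `x` with its pullback under the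
projection `v ↦ v - x v • e` onto the kernel of `x`. -/
theorem exists_eq_mul_add_of_apply_eq_one (x : Module.Dual K V) {e : V}
    (F : SymmetricAlgebra K (Module.Dual K V)) :
    ∃ F' : SymmetricAlgebra K (Module.Dual K V), ∀ v,
      evalAt v F = x v * evalAt v F' + evalAt (v - x v • e) F := by
  induction F using SymmetricAlgebra.induction with
  | algebraMap r => exact ⟨0, fun v => by simp⟩
  | ι u =>
    refine ⟨algebraMap K _ (u e), fun v => ?_⟩
    simp
  | mul f g hf hg =>
    obtain ⟨f', hf⟩ := hf
    obtain ⟨g', hg⟩ := hg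
    let π : SymmetricAlgebra K (Module.Dual K V) →ₐ[K] SymmetricAlgebra K (Module.Dual K V) :=
      SymmetricAlgebra.lift (SymmetricAlgebra.ι K _ -
        (Module.Dual.eval K V e).smulRight (SymmetricAlgebra.ι K _ x))
    have hπ : ∀ v F, evalAt v (π F) = evalAt (v - x v • e) F := by
      intro v F
      have : (evalAt v).comp π = evalAt (v - x v • e) := by
        ext1
        ext1 u
        simp [π]
        ring
      rw [← this]
      rfl
    -- Telescoping: `fg - π(f)π(g) = (f - π(f))g + π(f)(g - π(g))`.
    refine ⟨f' * g + π f * g', fun v => ?_⟩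
    rw [map_mul, map_mul, map_add, map_mul, map_mul, hπ]
    linear_combination hf v * evalAt v g + evalAt (v - x v • e) f * hg v
  | add f g hf hg =>
    obtain ⟨f', hf⟩ := hf
    obtain ⟨g', hg⟩ := hg
    refine ⟨f' + g', fun v => ?_⟩
    rw [map_add, map_add, map_add, hf, hg]
    ring

/-- Dividing a polynomial function on a subspace `W` by a linear form that does not vanish on
`W` lowers its degree in a direction `D ∈ W` by one if the form is nonzero at `D`, and does not
raise it otherwise. -/
theorem degree_lineAt_lt_of_mul [Infinite K] {W : Submodule K V} (x : Module.Dual K V)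
    {e : V} (he : e ∈ W) (hxe : x e = 1) {D : V} (hD : D ∈ W)
    {G F : SymmetricAlgebra K (Module.Dual K V)}
    (hGF : ∀ w ∈ W, evalAt w G = x w * evalAt w F) {n k : ℕ}
    (hk : k = 0 ∧ x D = 0 ∨ k = 1 ∧ x D ≠ 0)
    (hG : ∀ w ∈ W, (lineAt w D G).degree < (n + k : ℕ)) :
    ∀ w ∈ W, (lineAt w D F).degree < n := by
  have hline : ∀ w ∈ W, lineAt w D G = (C (x w) + C (x D) * X) * lineAt w D F := by
    intro w hw
    refine Polynomial.funext fun c => ?_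
    rw [eval_lineAt, hGF _ (W.add_mem hw (W.smul_mem c hD)), eval_mul, eval_lineAt]
    simp [-X_mul_C, mul_comm c]
  rcases hk with ⟨rfl, hxD⟩ | ⟨rfl, hxD⟩
  · have key : ∀ w ∈ W, x w ≠ 0 → (lineAt w D F).degree < n := by
      intro w hw hxw
      have := hG w hw
      rwa [hline w hw, hxD, C_0, zero_mul, add_zero, degree_C_mul hxw] at this
    intro w hw
    by_cases hxw : x w = 0
    · rw [degree_lt_iff_coeff_zero]
      intro m hm
      -- On the line through `w` the factor `x` is identically zero and gives no information. Moving
      -- `w` by `s • e` with `s ≠ 0` makes it a nonzero constant; the coefficient is a polynomial in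
      -- `s` with infinitely many zeros.
      have hz : (planeAt w e D F).coeff m = 0 := by
        refine eq_zero_of_infinite_isRoot _ (Set.Infinite.mono ?_
          (Set.Finite.infinite_compl (Set.finite_singleton (0 : K))))
        intro s hs
        have hs' : x (w + s • e) ≠ 0 := by simpa [hxw, hxe] using hs
        have := key _ (W.add_mem hw (W.smul_mem s he)) hs'
        rw [degree_lt_iff_coeff_zero] at this
        have := this m hm
        rwa [coeff_lineAt_add_smul] at this
      have := coeff_lineAt_add_smul w e D 0 F m
      rwa [hz, eval_zero, zero_smul, add_zero] at this
    · exact key w hw hxw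
  · intro w hw
    have h := hG w hw
    rw [hline w hw, degree_mul, add_comm (C (x w)), degree_linear hxD] at h
    by_cases h0 : lineAt w D F = 0
    · rw [h0, degree_zero]; exact WithBot.bot_lt_coe n
    · rw [degree_eq_natDegree h0] at h ⊢
      norm_cast at h ⊢
      omega

end Evaluation

end Zonotopal

/-! ### Directional degree bounds characterize the span of truncated products -/

namespace Zonotopal

open Polynomial

section Arrangement

variable {K V κ η : Type*} [Field K] [AddCommGroup V] [Module K V]

/-- The common kernel of the linear forms `x i`, for `i ∈ S`. -/
def commonKernel (x : κ → Module.Dual K V) (S : Set κ) : Submodule K V :=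
  ⨅ i ∈ S, LinearMap.ker (x i)

@[simp]
theorem mem_commonKernel {x : κ → Module.Dual K V} {S : Set κ} {v : V} :
    v ∈ commonKernel x S ↔ ∀ i ∈ S, x i v = 0 := by
  simp [commonKernel]

theorem commonKernel_insert (x : κ → Module.Dual K V) (S : Set κ) (i : κ) :
    commonKernel x (insert i S) = LinearMap.ker (x i) ⊓ commonKernel x S := by
  ext v
  simp

/-- The products of the linear forms `x i`, for `i` in a subset `Y` of `A`, such that `b h = 1`
whenever `D h` lies in `W` and all `x i` with `i ∈ A \ Y` vanish at `D h`. -/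
def truncatedProducts (x : κ → Module.Dual K V) (D : η → V) (b : η → Fin 2) (A : Finset κ)
    (W : Submodule K V) : Set (SymmetricAlgebra K (Module.Dual K V)) :=
  {p | ∃ Y ⊆ A, (∀ h, D h ∈ W → (∀ i ∈ A, i ∉ Y → x i (D h) = 0) → b h = 1) ∧
    p = ∏ i ∈ Y, SymmetricAlgebra.ι K _ (x i)}

open Classical in
/-- The number of forms `x i`, `i ∈ A`, that do not vanish at `v`. -/
noncomputable def nonvanishing (x : κ → Module.Dual K V) (A : Finset κ) (v : V) : ℕ :=
  (A.filter fun i => x i v ≠ 0).card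

/-- A form outside `Y` that is nonzero at `v` is counted for `A` but not for `Y`; if there is none,
the strict inequality comes from `b = 1`. -/
theorem nonvanishing_lt {x : κ → Module.Dual K V} {A Y : Finset κ} (hY : Y ⊆ A) {v : V}
    {b : Fin 2} (hb : (∀ i ∈ A, i ∉ Y → x i v = 0) → b = 1) :
    nonvanishing x Y v < nonvanishing x A v + b := by
  classical
  have hle : nonvanishing x Y v ≤ nonvanishing x A v :=
    Finset.card_le_card (Finset.filter_subset_filter _ hY)
  by_cases h : ∀ i ∈ A, i ∉ Y → x i v = 0
  · rw [hb h]
    exact Nat.lt_succ_of_le hle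
  · push Not at h
    obtain ⟨i, hiA, hiY, hi⟩ := h
    refine Nat.lt_add_right _ (Finset.card_lt_card ?_)
    refine (Finset.filter_subset_filter _ hY).ssubset_of_ne fun heq => hiY ?_
    have : i ∈ A.filter fun i => x i v ≠ 0 := by simp [hiA, hi]
    rw [← heq] at this
    exact (Finset.mem_filter.1 this).1

theorem degree_lineAt_prod_le (x : κ → Module.Dual K V) (Y : Finset κ) (w D : V) :
    (lineAt w D (∏ i ∈ Y, SymmetricAlgebra.ι K _ (x i))).degree ≤ (nonvanishing x Y D : ℕ) := by
  classical
  rw [map_prod]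
  refine (degree_prod_le _ _).trans ?_
  rw [nonvanishing, Finset.card_filter, Nat.cast_sum]
  refine Finset.sum_le_sum fun i _ => ?_
  rw [lineAt_ι]
  split_ifs with h
  · rw [add_comm]; exact degree_linear_le
  · simp only [ne_eq, not_not] at h
    rw [h, C_0, zero_mul, add_zero]
    exact degree_C_le

/-- The easy inclusion; it also ensures that subtracting such a combination from `F` preserves the
degree bounds. -/
theorem degree_lineAt_lt_of_mem_span {x : κ → Module.Dual K V} {D : η → V} {b : η → Fin 2}
    {A : Finset κ} {W : Submodule K V} {F : SymmetricAlgebra K (Module.Dual K V)}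
    (hF : F ∈ Submodule.span K (truncatedProducts x D b A W)) {h : η} (hW : D h ∈ W) (w : V) :
    (lineAt w (D h) F).degree < (nonvanishing x A (D h) + b h : ℕ) := by
  have : Submodule.span K (truncatedProducts x D b A W) ≤
      (degreeLT K (nonvanishing x A (D h) + b h)).comap (lineAt w (D h)).toLinearMap := by
    rw [Submodule.span_le]
    rintro _ ⟨Y, hY, hb, rfl⟩
    rw [SetLike.mem_coe, Submodule.mem_comap, AlgHom.toLinearMap_apply, mem_degreeLT]
    exact (degree_lineAt_prod_le x Y w (D h)).trans_lt
      (WithBot.coe_lt_coe.2 (nonvanishing_lt hY (hb h hW)))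
  exact mem_degreeLT.1 (this hF)

theorem nonvanishing_insert_eq [DecidableEq κ] (x : κ → Module.Dual K V) {A : Finset κ} {i : κ}
    (hi : i ∈ A) (v : V) : ∃ k, (k = 0 ∧ x i v = 0 ∨ k = 1 ∧ x i v ≠ 0) ∧
      nonvanishing x A v = nonvanishing x (A.erase i) v + k := by
  classical
  unfold nonvanishing
  rw [Finset.filter_erase]
  by_cases h : x i v = 0
  · refine ⟨0, .inl ⟨rfl, h⟩, ?_⟩
    rw [Finset.erase_eq_of_notMem (by simp [h]), add_zero]
  · refine ⟨1, .inr ⟨rfl, h⟩, ?_⟩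
    rw [Finset.card_erase_add_one (by simp [h, hi])]

/-- Adding `i` to both `Y` and the ambient set leaves the complement of `Y`, and hence the condition
on `b`, unchanged. -/
theorem mul_mem_span_truncatedProducts [DecidableEq κ] {x : κ → Module.Dual K V} {D : η → V}
    {b : η → Fin 2} {A : Finset κ} {W : Submodule K V} {i : κ} (hi : i ∈ A)
    {F : SymmetricAlgebra K (Module.Dual K V)}
    (hF : F ∈ Submodule.span K (truncatedProducts x D b (A.erase i) W)) :
    SymmetricAlgebra.ι K _ (x i) * F ∈ Submodule.span K (truncatedProducts x D b A W) := by
  have : Submodule.span K (truncatedProducts x D b (A.erase i) W) ≤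
      (Submodule.span K (truncatedProducts x D b A W)).comap
        (LinearMap.mulLeft K (SymmetricAlgebra.ι K _ (x i))) := by
    rw [Submodule.span_le]
    rintro _ ⟨Y, hY, hb, rfl⟩
    have hiY : i ∉ Y := fun h => Finset.notMem_erase i A (hY h)
    refine Submodule.subset_span ⟨insert i Y, ?_, fun h hW hv => hb h hW fun j hj hjY => ?_, ?_⟩
    · exact Finset.insert_subset hi (hY.trans (Finset.erase_subset _ _))
    · refine hv j (Finset.mem_of_mem_erase hj) ?_
      simp [Finset.ne_of_mem_erase hj, hjY]
    · simp [Finset.prod_insert hiY]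
  exact this hF

/-- Passing from `W` to its hyperplane where `x i` vanishes keeps the products that do not
involve `x i`; all others vanish there. -/
theorem exists_mem_span_truncatedProducts_of_inf_ker {x : κ → Module.Dual K V} {D : η → V}
    {b : η → Fin 2} {A : Finset κ} {W : Submodule K V} {i : κ} (hi : i ∈ A)
    {P : SymmetricAlgebra K (Module.Dual K V)}
    (hP : P ∈ Submodule.span K (truncatedProducts x D b A (LinearMap.ker (x i) ⊓ W))) :
    ∃ Q ∈ Submodule.span K (truncatedProducts x D b A W),
      ∀ w ∈ LinearMap.ker (x i) ⊓ W, evalAt w P = evalAt w Q := by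
  induction hP using Submodule.span_induction with
  | mem P hP =>
    obtain ⟨Y, hY, hb, rfl⟩ := hP
    by_cases hiY : i ∈ Y
    · refine ⟨0, zero_mem _, fun w hw => ?_⟩
      rw [map_prod, map_zero]
      exact Finset.prod_eq_zero hiY (by simpa using hw.1)
    -- Here `i` is among the omitted indices, so the condition only concerns `D h` with `x i (D h) =
    -- 0`: requiring it on `W` or on `ker (x i) ⊓ W` is the same.
    · exact ⟨_, Submodule.subset_span ⟨Y, hY, fun h hW hv => hb h ⟨hv i hi hiY, hW⟩ hv, rfl⟩,
        fun _ _ => rfl⟩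
  | zero => exact ⟨0, zero_mem _, fun _ _ => rfl⟩
  | add P P' _ _ h h' =>
    obtain ⟨Q, hQ, h⟩ := h
    obtain ⟨Q', hQ', h'⟩ := h'
    exact ⟨Q + Q', add_mem hQ hQ', fun w hw => by rw [map_add, map_add, h w hw, h' w hw]⟩
  | smul c P _ h =>
    obtain ⟨Q, hQ, h⟩ := h
    exact ⟨c • Q, Submodule.smul_mem _ c hQ, fun w hw => by rw [map_smul, map_smul, h w hw]⟩

/-- A polynomial function on `W` that is constant along a spanning set of directions is
constant. -/
theorem evalAt_eq_of_degree_lineAt_lt_one {W : Submodule K V} {T : Set V} (hT : T ⊆ W)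
    (hW : W ≤ Submodule.span K T) {F : SymmetricAlgebra K (Module.Dual K V)}
    (hF : ∀ v ∈ T, ∀ w ∈ W, (lineAt w v F).degree < 1) {w : V} (hw : w ∈ W) :
    evalAt w F = evalAt 0 F := by
  have key : ∀ v ∈ Submodule.span K T, ∀ w ∈ W, evalAt (w + v) F = evalAt w F := by
    intro v hv
    induction hv using Submodule.closure_induction with
    | zero => intro w _; rw [add_zero]
    | add v v' hv hv' h h' =>
      intro w hw
      rw [← add_assoc, h' _ (W.add_mem hw (Submodule.span_le.2 hT hv)), h w hw]
    | smul_mem c v hv =>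
      intro w hw
      have h1 : (lineAt w v F).degree ≤ 0 := by
        have : (lineAt w v F).degree < (1 : ℕ) := hF v hv w hw
        rw [degree_lt_iff_coeff_zero] at this
        rw [degree_le_iff_coeff_zero]
        exact fun m hm => this m (by exact_mod_cast hm)
      have h2 := eval_lineAt w v c F
      have h3 := eval_lineAt w v 0 F
      rw [eq_C_of_degree_le_zero h1, eval_C] at h2 h3
      rw [← h2, h3, zero_smul, add_zero]
  simpa using key w (hW hw) 0 W.zero_mem

/-- Let `D` be a family of vectors such that every common kernel `W` of some of the forms `x i`
is spanned by the vectors `D h` that it contains. A polynomial function on `W` whose degree in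
the direction `D h ∈ W` is less than the number of forms `x i` with `x i (D h) ≠ 0`, plus `b h`,
is a linear combination of truncated products. -/
theorem exists_mem_span_truncatedProducts [Infinite K] [FiniteDimensional K V]
    (x : κ → Module.Dual K V) (D : η → V) (b : η → Fin 2)
    (hspan : ∀ S : Set κ,
      commonKernel x S ≤ Submodule.span K {v ∈ Set.range D | v ∈ commonKernel x S})
    (A : Finset κ) (S : Set κ) (F : SymmetricAlgebra K (Module.Dual K V))
    (hF : ∀ h, D h ∈ commonKernel x S → ∀ w ∈ commonKernel x S,
      (lineAt w (D h) F).degree < (nonvanishing x A (D h) + b h : ℕ)) :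
    ∃ P ∈ Submodule.span K (truncatedProducts x D b A (commonKernel x S)),
      ∀ w ∈ commonKernel x S, evalAt w F = evalAt w P := by
  classical
  -- Restricting to `ker (x i)` lowers the dimension, dividing by `x i` lowers the cardinality;
  -- their sum drops in both cases.
  induction hn : A.card + Module.finrank K (commonKernel x S) using Nat.strong_induction_on
    generalizing A S F with
  | _ n ih =>
  by_cases hA : ∃ i ∈ A, ∃ e ∈ commonKernel x S, x i e ≠ 0
  · obtain ⟨i, hiA, e, he, hxe⟩ := hA
    set W := commonKernel x S with hWdef
    have hins := commonKernel_insert x S i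
    rw [← hWdef] at hins
    obtain ⟨P, hP, hFP⟩ := ih (A.card + Module.finrank K (commonKernel x (insert i S)))
      (by
        rw [← hn]
        refine Nat.add_lt_add_left (Submodule.finrank_lt_finrank_of_lt ?_) _
        rw [hins]
        exact inf_le_right.lt_of_ne fun h => hxe ((h.symm ▸ he : e ∈ _ ⊓ W).1))
      A (insert i S) F
      (fun h hh w hw => hF h (hins ▸ hh : D h ∈ _ ⊓ W).2 w (hins ▸ hw : w ∈ _ ⊓ W).2) rfl
    rw [hins] at hP hFP
    obtain ⟨Q, hQ, hPQ⟩ := exists_mem_span_truncatedProducts_of_inf_ker hiA hP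
    set e' := (x i e)⁻¹ • e
    have he' : e' ∈ W := W.smul_mem _ he
    have hxe' : x i e' = 1 := by simp [e', hxe]
    obtain ⟨F', hF'⟩ := exists_eq_mul_add_of_apply_eq_one (x i) (e := e') (F - Q)
    have hdiv : ∀ w ∈ W, evalAt w (F - Q) = x i w * evalAt w F' := by
      intro w hw
      have hmem : w - x i w • e' ∈ LinearMap.ker (x i) ⊓ W :=
        ⟨by simp [hxe'], W.sub_mem hw (W.smul_mem _ he')⟩
      rw [hF' w, map_sub (evalAt (w - x i w • e')), hFP _ hmem, hPQ _ hmem, sub_self, add_zero]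
    obtain ⟨P', hP', hFP'⟩ := ih ((A.erase i).card + Module.finrank K W)
      (by rw [← hn]; exact Nat.add_lt_add_right (Finset.card_erase_lt_of_mem hiA) _)
      (A.erase i) S F'
      (fun h hh => by
        obtain ⟨k, hk, hcard⟩ := nonvanishing_insert_eq x hiA (D h)
        refine degree_lineAt_lt_of_mul (x i) he' hxe' hh hdiv hk fun w hw => ?_
        have h1 := hF h hh w hw
        have h2 := degree_lineAt_lt_of_mem_span hQ hh w
        rw [hcard, add_right_comm] at h1 h2
        rw [map_sub]
        exact (degree_sub_le _ _).trans_lt (max_lt h1 h2)) rfl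
    refine ⟨SymmetricAlgebra.ι K _ (x i) * P' + Q,
      add_mem (mul_mem_span_truncatedProducts hiA hP') hQ, fun w hw => ?_⟩
    have h1 := hdiv w hw
    rw [map_sub, hFP' w hw] at h1
    rw [map_add, map_mul, evalAt_ι, ← h1, sub_add_cancel]
  · push Not at hA
    have hzero : ∀ h, D h ∈ commonKernel x S → nonvanishing x A (D h) = 0 := by
      intro h hh
      rw [nonvanishing, Finset.card_eq_zero, Finset.filter_eq_empty_iff]
      intro i hi
      simpa using hA i hi _ hh
    -- All counts are now zero, so the bound reads `degree < b h`. If every `b h` is `1`, the empty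
    -- product is admissible and `F` is constant on `W`; a single `b h = 0` forces `F` to vanish on
    -- `W`.
    by_cases hb : ∀ h, D h ∈ commonKernel x S → b h = 1
    · refine ⟨evalAt 0 F • 1, Submodule.smul_mem _ _ (Submodule.subset_span
        ⟨∅, Finset.empty_subset _, fun h hh _ => hb h hh, by simp⟩), fun w hw => ?_⟩
      rw [map_smul, map_one, smul_eq_mul, mul_one]
      refine evalAt_eq_of_degree_lineAt_lt_one (fun v hv => hv.2) (hspan S) ?_ hw
      rintro _ ⟨⟨h, rfl⟩, hh⟩ w hw
      have := hF h hh w hw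
      rw [hzero h hh, hb h hh] at this
      simpa using this
    · push Not at hb
      obtain ⟨h, hh, hb⟩ := hb
      refine ⟨0, zero_mem _, fun w hw => ?_⟩
      have h0 : b h = 0 := by omega
      have h1 := hF h hh w hw
      rw [hzero h hh, h0] at h1
      have h2 : lineAt w (D h) F = 0 := by
        rw [← degree_eq_bot, ← Nat.WithBot.lt_zero_iff]
        simpa using h1
      have h3 := eval_lineAt w (D h) 0 F
      rw [h2] at h3
      simpa using h3.symm

end Arrangement

end Zonotopal

/-! ### Hyperplane normals and the translation from flats to kernels -/

namespace Zonotopal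

section Hyperplanes

variable {K V ι : Type*} [Field K] [AddCommGroup V] [Module K V]

theorem span_image_clos {U : Type*} [AddCommGroup U] [Module K U] (X : ι → U) (Y : Set ι) :
    Submodule.span K (X '' clos K X Y) = Submodule.span K (X '' Y) := by
  refine le_antisymm ?_ (Submodule.span_mono (Set.image_mono (subset_clos K X Y)))
  rw [Submodule.span_le]
  rintro _ ⟨i, hi, rfl⟩
  exact hi

theorem clos_subset_flat_iff {U : Type*} [AddCommGroup U] [Module K U] (X : ι → U) (Y : Set ι)
    (C : Flat K X) : clos K X Y ⊆ C.1 ↔ Y ⊆ C.1 :=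
  ⟨(subset_clos K X Y).trans, fun h => (clos_mono K X h).trans C.2.subset⟩

theorem commonKernel_eq_dualCoannihilator (X : ι → Module.Dual K V) (S : Set ι) :
    commonKernel X S = (Submodule.span K (X '' S)).dualCoannihilator := by
  ext v
  rw [mem_commonKernel, ← SetLike.mem_coe, Submodule.coe_dualCoannihilator_span]
  simp

theorem exists_apply_ne_zero [FiniteDimensional K V] {X : ι → Module.Dual K V}
    (hX : Submodule.span K (Set.range X) = ⊤) {v : V} (hv : v ≠ 0) : ∃ i, X i v ≠ 0 := by
  by_contra! h
  refine hv ?_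
  have : v ∈ commonKernel X Set.univ := by simpa using h
  rw [commonKernel_eq_dualCoannihilator, Set.image_univ, hX] at this
  simpa using this

/-- Every common kernel of some of the vectors in a spanning family `X` is spanned by the normals
of hyperplanes of `X` that it contains. -/
theorem commonKernel_le_span_normals [FiniteDimensional K V] (X : ι → Module.Dual K V)
    (hX : Submodule.span K (Set.range X) = ⊤) (D : Hyperplane K X → V)
    (hD : ∀ H, {i | X i (D H) = 0} = H.1.1) (S : Set ι) :
    commonKernel X S ≤ Submodule.span K {v ∈ Set.range D | v ∈ commonKernel X S} := by
  induction hn : Module.finrank K (commonKernel X S) using Nat.strong_induction_on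
    generalizing S with
  | _ n ih =>
  have hsub : ∀ (i : ι) (e : V), e ∈ commonKernel X S → X i e ≠ 0 →
      commonKernel X (insert i S) ≤
        Submodule.span K {v ∈ Set.range D | v ∈ commonKernel X S} := by
    intro i e he hie
    have hle : commonKernel X (insert i S) ≤ commonKernel X S := by
      rw [commonKernel_insert]; exact inf_le_right
    refine (ih _ ?_ _ rfl).trans (Submodule.span_mono fun v hv => ⟨hv.1, hle hv.2⟩)
    rw [← hn]
    refine Submodule.finrank_lt_finrank_of_lt (hle.lt_of_ne fun h => hie ?_)
    rw [← h, commonKernel_insert] at he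
    exact he.1
  by_cases hW : commonKernel X S = ⊥
  · rw [hW]; exact bot_le
  obtain ⟨e, he, he0⟩ := Submodule.exists_mem_ne_zero_of_ne_bot hW
  obtain ⟨i, hie⟩ := exists_apply_ne_zero hX he0
  by_cases hW' : commonKernel X (insert i S) = ⊥
  -- The kernel is a line, so the closure of `S` is a hyperplane, whose normal is nonzero and lies
  -- on that line.
  · have hspan : commonKernel X S = Submodule.span K {e} := by
      refine le_antisymm (fun w hw => ?_) (by simpa using he)
      have : w - (X i w / X i e) • e ∈ commonKernel X (insert i S) := by
        rw [commonKernel_insert]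
        exact ⟨by simp [hie], sub_mem hw (Submodule.smul_mem _ _ he)⟩
      rw [hW', Submodule.mem_bot, sub_eq_zero] at this
      rw [this]
      exact Submodule.smul_mem _ _ (Submodule.mem_span_singleton_self e)
    have hrank : rk K X (closFlat K X S).1 + 1 = Module.finrank K (Module.Dual K V) := by
      rw [Subspace.dual_finrank_eq, ← Subspace.finrank_add_finrank_dualCoannihilator_eq
        (Submodule.span K (X '' S)), ← commonKernel_eq_dualCoannihilator, hspan,
        finrank_span_singleton he0, rk, closFlat, span_image_clos]
    let H : Hyperplane K X := ⟨closFlat K X S, hrank⟩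
    have hDS : D H ∈ commonKernel X S := by
      rw [mem_commonKernel]
      intro j hj
      have : j ∈ H.1.1 := subset_clos K X S hj
      rwa [← hD H] at this
    have hD0 : D H ≠ 0 := by
      intro h0
      have huniv : H.1.1 = Set.univ := by
        rw [← hD H, h0]
        simp
      have := H.2
      rw [rk, huniv, Set.image_univ, hX, finrank_top] at this
      omega
    refine fun w hw => ?_
    rw [hspan, Submodule.mem_span_singleton] at hDS hw
    obtain ⟨c, hc⟩ := hDS
    obtain ⟨k, rfl⟩ := hw
    have hc0 : c ≠ 0 := by
      rintro rfl
      exact hD0 (by rw [← hc, zero_smul])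
    have : k • e = (k / c) • D H := by
      rw [← hc, smul_smul, div_mul_cancel₀ _ hc0]
    rw [this]
    refine Submodule.smul_mem _ _ (Submodule.subset_span ⟨⟨H, rfl⟩, ?_⟩)
    rw [← hc]
    exact Submodule.smul_mem _ _ he
  -- In dimension at least two the kernel is the sum of two smaller common kernels, cut out by `X i`
  -- and `X j`: a multiple of `e'` lies in the first and corrects any `w` into the second.
  · obtain ⟨e', he', he0'⟩ := Submodule.exists_mem_ne_zero_of_ne_bot hW'
    obtain ⟨j, hje⟩ := exists_apply_ne_zero hX he0'
    have heS : e' ∈ commonKernel X S := by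
      rw [commonKernel_insert] at he'
      exact he'.2
    intro w hw
    rw [← sub_add_cancel w ((X j w / X j e') • e')]
    refine add_mem (hsub j e' heS hje ?_) (hsub i e he hie (Submodule.smul_mem _ _ he'))
    rw [commonKernel_insert]
    exact ⟨by simp [hje], sub_mem hw (Submodule.smul_mem _ _ heS)⟩

/-- The vectors of `X(a)` have the same common kernels as the corresponding vectors of `X`. -/
theorem commonKernel_replicate (X : ι → Module.Dual K V) (a : ι → ℕ)
    (S : Set (Σ i, Fin (a i))) :
    commonKernel (replicate X a) S = commonKernel X (Sigma.fst '' S) := by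
  ext v
  simp only [mem_commonKernel, Set.forall_mem_image]
  rfl

/-- The space `P(X(a), 0, J_b)` is spanned by the truncated products for the hyperplane
normals. -/
theorem pSpaceZero_eq_span_truncatedProducts [Fintype ι] (X : ι → Module.Dual K V)
    (D : Hyperplane K X → V) (hD : ∀ H, {i | X i (D H) = 0} = H.1.1) (a : ι → ℕ)
    (b : Hyperplane K X → Fin 2) :
    pSpaceZero K (replicate X a) (upperSetReplicate K X a (upperSetOf K X b)) =
      Submodule.span K (truncatedProducts (replicate X a) D b Finset.univ ⊤) := by
  -- Vanishing at `D H` is a linear condition, so it passes to closures in `X(a)` and in `X`;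
  -- membership in `J_b` thus becomes a condition on values at normals.
  have hclos : ∀ (Z : Set (Σ i, Fin (a i))) (H : Hyperplane K X),
      closFlat K X (Sigma.fst '' clos K (replicate X a) Z) ≤ H.1 ↔
        ∀ p ∈ Z, replicate X a p (D H) = 0 := by
    intro Z H
    change clos K X _ ⊆ H.1.1 ↔ _
    rw [clos_subset_flat_iff, Set.image_subset_iff, ← hD H]
    refine ⟨fun h p hp => h (subset_clos K _ Z hp), fun h p hp => ?_⟩
    have : Submodule.span K (replicate X a '' Z) ≤
        LinearMap.ker (Module.Dual.eval K V (D H)) := by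
      rw [Submodule.span_le]
      rintro _ ⟨q, hq, rfl⟩
      exact h q hq
    exact this hp
  unfold pSpaceZero
  congr 1
  ext p
  refine exists_congr fun Y => ?_
  have : closFlat K (replicate X a) ((Y : Set _)ᶜ) ∈
      upperSetReplicate K X a (upperSetOf K X b) ↔
      ∀ H, closFlat K X (Sigma.fst '' clos K (replicate X a) ((Y : Set _)ᶜ)) ≤ H.1 → b H = 1 :=
    Iff.rfl
  rw [this]
  simp only [hclos]
  simp

/-- The number of vectors of `X(a)` outside a hyperplane. -/
theorem nonvanishing_replicate [Fintype ι] (X : ι → Module.Dual K V)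
    (D : Hyperplane K X → V) (hD : ∀ H, {i | X i (D H) = 0} = H.1.1) (a : ι → ℕ)
    (H : Hyperplane K X) :
    (nonvanishing (replicate X a) Finset.univ (D H) : ℤ) =
      (nonContainment K X *ᵥ fun i => (a i : ℤ)) H := by
  classical
  have hmem : ∀ i, i ∈ H.1.1 ↔ X i (D H) = 0 := fun i => by rw [← hD H]; rfl
  rw [nonvanishing, Finset.card_filter, Fintype.sum_sigma, Matrix.mulVec, dotProduct]
  push_cast
  refine Finset.sum_congr rfl fun i _ => ?_
  by_cases h : X i (D H) = 0 <;> simp [replicate, nonContainment, hmem, h]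

end Hyperplanes

end Zonotopal

/-! ### Dehomogenization `s = 1` -/

namespace Zonotopal

open MvPolynomial

section Homogenization

variable {K σ : Type*} [Field K]

/-- The exponent of `t` in a monomial in `s` and `t`. -/
noncomputable def tExponent (m : σ ⊕ σ →₀ ℕ) : σ →₀ ℕ :=
  m.comapDomain Sum.inr Sum.inr_injective.injOn

theorem setSOne_monomial (m : σ ⊕ σ →₀ ℕ) (c : K) :
    setSOne K σ (monomial m c) = monomial (tExponent m) c := by
  rw [setSOne, aeval_monomial, monomial_eq, tExponent,
    ← Finsupp.comapDomain_sumElim_comapDomain m, Finsupp.prod_sumElim]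
  simp [Function.comp_def]

theorem coeff_setSOne [DecidableEq σ] (g : STRing K σ) (β : σ →₀ ℕ) :
    coeff β (setSOne K σ g) =
      ∑ m ∈ g.support, if tExponent m = β then coeff m g else 0 := by
  conv_lhs => rw [g.as_sum, map_sum, coeff_sum]
  exact Finset.sum_congr rfl fun m _ => by rw [setSOne_monomial, coeff_monomial]

/-- The part of the multigrading given by the degrees in the pairs of variables `s i`, `t i`. -/
noncomputable def pairWeight (σ : Type*) : σ ⊕ σ → σ → ℤ := fun i => (stWeight σ i).2

theorem weight_pairWeight (m : σ ⊕ σ →₀ ℕ) :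
    Finsupp.weight (pairWeight σ) m = (Finsupp.weight (stWeight σ) m).2 := by
  simp [Finsupp.weight_apply, Finsupp.sum, Prod.snd_sum, pairWeight]

theorem isWeightedHomogeneous_pairWeight {g : STRing K σ} {d : ℤ} {u : σ → ℤ}
    (hg : IsWeightedHomogeneous (stWeight σ) g (d, u)) :
    IsWeightedHomogeneous (pairWeight σ) g u := fun m hm => by
  rw [weight_pairWeight, hg hm]

variable [Fintype σ]

theorem weight_stWeight (m : σ ⊕ σ →₀ ℕ) :
    Finsupp.weight (stWeight σ) m =
      (∑ i, (m (Sum.inr i) : ℤ), fun i => (m (Sum.inl i) : ℤ) + m (Sum.inr i)) := by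
  classical
  rw [Finsupp.weight_apply, Finsupp.sum_fintype _ _ (by simp), Fintype.sum_sum_type]
  ext
  · simp [stWeight, Prod.fst_sum]
  · simp [stWeight, Prod.snd_sum, Finset.sum_apply, Pi.single_apply]

theorem weight_stWeight_eq_iff {m : σ ⊕ σ →₀ ℕ} {d : ℕ} {u : σ → ℤ} :
    Finsupp.weight (stWeight σ) m = ((d : ℤ), u) ↔
      ∑ i, tExponent m i = d ∧ ∀ i, (m (Sum.inl i) : ℤ) + tExponent m i = u i := by
  rw [weight_stWeight, Prod.ext_iff, funext_iff]
  refine and_congr ?_ Iff.rfl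
  rw [← Nat.cast_inj (R := ℤ)]
  push_cast
  rfl

/-- The exponent of `s i` is forced to be `u i` minus that of `t i`. -/
theorem eq_of_tExponent_eq {m m' : σ ⊕ σ →₀ ℕ} {u : σ → ℤ}
    (hm : Finsupp.weight (pairWeight σ) m = u) (hm' : Finsupp.weight (pairWeight σ) m' = u)
    (h : tExponent m = tExponent m') : m = m' := by
  rw [weight_pairWeight, weight_stWeight, funext_iff] at hm hm'
  have h' : ∀ i, m (Sum.inr i) = m' (Sum.inr i) := fun i => DFunLike.congr_fun h i
  ext (i | i)
  · have h1 := hm i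
    have h2 := hm' i
    have h3 := h' i
    simp only at h1 h2
    omega
  · exact h' i

/-- No two monomials of the same pair degrees merge when `s = 1`. -/
theorem coeff_tExponent_setSOne {g : STRing K σ} {u : σ → ℤ}
    (hg : IsWeightedHomogeneous (pairWeight σ) g u) {m : σ ⊕ σ →₀ ℕ}
    (hm : Finsupp.weight (pairWeight σ) m = u) :
    coeff (tExponent m) (setSOne K σ g) = coeff m g := by
  classical
  rw [coeff_setSOne, Finset.sum_eq_single m, if_pos rfl]
  · intro m' hm' hne
    rw [if_neg fun h => hne (eq_of_tExponent_eq (hg (mem_support_iff.1 hm')) hm h)]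
  · intro h
    rw [if_pos rfl, notMem_support_iff.1 h]

/-- A polynomial that is homogeneous in each pair `s i`, `t i` is determined by its
dehomogenization. -/
theorem eq_of_setSOne_eq {g g' : STRing K σ} {u : σ → ℤ}
    (hg : IsWeightedHomogeneous (pairWeight σ) g u)
    (hg' : IsWeightedHomogeneous (pairWeight σ) g' u)
    (h : setSOne K σ g = setSOne K σ g') : g = g' := by
  ext m
  by_cases hm : Finsupp.weight (pairWeight σ) m = u
  · rw [← coeff_tExponent_setSOne hg hm, ← coeff_tExponent_setSOne hg' hm, h]
  · rw [hg.coeff_eq_zero m hm, hg'.coeff_eq_zero m hm]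

/-- The exponents that occur in the dehomogenization of a polynomial of multidegree `(d, u)`. -/
theorem exponent_setSOne {g : STRing K σ} {d : ℕ} {u : σ → ℤ}
    (hg : IsWeightedHomogeneous (stWeight σ) g ((d : ℤ), u)) {β : σ →₀ ℕ}
    (hβ : β ∈ (setSOne K σ g).support) : ∑ i, β i = d ∧ ∀ i, (β i : ℤ) ≤ u i := by
  classical
  rw [mem_support_iff, coeff_setSOne] at hβ
  obtain ⟨m, hm, hne⟩ := Finset.exists_ne_zero_of_sum_ne_zero hβ
  obtain rfl : tExponent m = β := by
    by_contra h
    exact hne (if_neg h)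
  have := weight_stWeight_eq_iff.1 (hg (mem_support_iff.1 hm))
  exact ⟨this.1, fun i => by have := this.2 i; omega⟩

/-- Every polynomial of degree `d` whose degree in each variable `t i` is at most `u i` is the
dehomogenization of a polynomial of multidegree `(d, u)`. -/
theorem exists_setSOne_eq {q : MvPolynomial σ K} {d : ℕ} {u : σ → ℤ}
    (hq : ∀ β ∈ q.support, ∑ i, β i = d ∧ ∀ i, (β i : ℤ) ≤ u i) :
    ∃ g : STRing K σ, IsWeightedHomogeneous (stWeight σ) g ((d : ℤ), u) ∧
      setSOne K σ g = q := by
  -- Each `t i ^ β i` is padded with `s i ^ (u i - β i)`; `toNat` truncates nothing on the support,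
  -- where `β i ≤ u i`.
  let lift (β : σ →₀ ℕ) : σ ⊕ σ →₀ ℕ :=
    Finsupp.sumElim (Finsupp.equivFunOnFinite.symm fun i => (u i - β i).toNat) β
  have hlift : ∀ β, tExponent (lift β) = β := fun β => by
    ext i
    simp [lift, tExponent]
  refine ⟨∑ β ∈ q.support, monomial (lift β) (coeff β q),
    IsWeightedHomogeneous.sum _ _ _ fun β hβ =>
      isWeightedHomogeneous_monomial _ _ _ ?_, ?_⟩
  · rw [weight_stWeight_eq_iff, hlift]
    refine ⟨(hq β hβ).1, fun i => ?_⟩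
    have := (hq β hβ).2 i
    simp only [lift, Finsupp.sumElim_inl, Finsupp.equivFunOnFinite_symm_apply_apply]
    omega
  · conv_rhs => rw [q.as_sum]
    rw [map_sum]
    exact Finset.sum_congr rfl fun β _ => by rw [setSOne_monomial, hlift]

end Homogenization

/-! ### Invariants as polynomial functions on `V` -/

section Action

variable {K σ : Type*} [Field K]

/-- Substituting polynomials of the same weights for the variables preserves weighted
homogeneity. -/
theorem isWeightedHomogeneous_aeval {τ M : Type*} [AddCommMonoid M] {w : σ → M} {w' : τ → M}
    {f : σ → MvPolynomial τ K} (hf : ∀ i, IsWeightedHomogeneous w' (f i) (w i))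
    {φ : MvPolynomial σ K} {n : M} (hφ : IsWeightedHomogeneous w φ n) :
    IsWeightedHomogeneous w' (aeval f φ) n := by
  rw [aeval_def, eval₂_eq]
  refine IsWeightedHomogeneous.sum _ _ _ fun m hm => ?_
  have h := (IsWeightedHomogeneous.prod m.support (fun i => f i ^ m i) (fun i => m i • w i)
    fun i _ => (hf i).pow (m i)).C_mul (coeff m φ)
  rwa [← hφ (mem_support_iff.1 hm), Finsupp.weight_apply]

theorem isWeightedHomogeneous_nagataAction (l : σ → K) {g : STRing K σ} {u : σ → ℤ}
    (hg : IsWeightedHomogeneous (pairWeight σ) g u) :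
    IsWeightedHomogeneous (pairWeight σ) (nagataAction K l g) u := by
  refine isWeightedHomogeneous_aeval ?_ hg
  rintro (i | i)
  · exact isWeightedHomogeneous_X K (pairWeight σ) (Sum.inl i)
  · exact (isWeightedHomogeneous_X K (pairWeight σ) (Sum.inr i)).add
      ((isWeightedHomogeneous_X K (pairWeight σ) (Sum.inl i)).C_mul (l i))

/-- The translation `t i ↦ t i + l i`. -/
noncomputable def translate (l : σ → K) : MvPolynomial σ K →ₐ[K] MvPolynomial σ K :=
  aeval fun i => X i + C (l i)

theorem setSOne_nagataAction (l : σ → K) (g : STRing K σ) :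
    setSOne K σ (nagataAction K l g) = translate l (setSOne K σ g) := by
  have : (setSOne K σ).comp (nagataAction K l) = (translate l).comp (setSOne K σ) := by
    ext (i | i) <;> simp [setSOne, nagataAction, translate, algHom_C]
  exact DFunLike.congr_fun this g

theorem eval_translate (l t : σ → K) (q : MvPolynomial σ K) :
    eval t (translate l q) = eval (t + l) q := by
  have : (aeval t).comp (translate l) = (aeval (t + l) : MvPolynomial σ K →ₐ[K] K) := by
    ext i
    simp [translate]
  simpa [aeval_eq_eval] using DFunLike.congr_fun this q

variable {V : Type*} [AddCommGroup V] [Module K V] [Fintype σ] (D : σ → V)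

theorem mem_coxNagata_iff {g : STRing K σ} :
    g ∈ coxNagata K D ↔ ∀ l ∈ relations K D, nagataAction K l g = g := by
  simp [coxNagata, Algebra.mem_iInf]

/-- A polynomial that is homogeneous in each pair `s i`, `t i` is invariant if and only if its
dehomogenization is invariant under the translations by the relations among the `D i`. -/
theorem mem_coxNagata_iff_translate {g : STRing K σ} {u : σ → ℤ}
    (hg : IsWeightedHomogeneous (pairWeight σ) g u) :
    g ∈ coxNagata K D ↔ ∀ l ∈ relations K D, translate l (setSOne K σ g) = setSOne K σ g := by
  rw [mem_coxNagata_iff]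
  refine forall₂_congr fun l _ => ⟨fun h => ?_, fun h => ?_⟩
  · rw [← setSOne_nagataAction, h]
  · exact eq_of_setSOne_eq (isWeightedHomogeneous_nagataAction l hg) hg
      (by rw [setSOne_nagataAction, h])

theorem pullback_ι (x : Module.Dual K V) :
    pullback K D (SymmetricAlgebra.ι K _ x) = ∑ i, C (x (D i)) * X i := by
  simp [pullback, smul_eq_C_mul, LinearMap.sum_apply]

theorem eval_pullback (F : SymmetricAlgebra K (Module.Dual K V)) (t : σ → K) :
    eval t (pullback K D F) = evalAt (∑ i, t i • D i) F := by
  have : (aeval t : MvPolynomial σ K →ₐ[K] K).comp (pullback K D) =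
      evalAt (∑ i, t i • D i) := by
    ext x
    simp [pullback, mul_comm, LinearMap.sum_apply]
  simpa [aeval_eq_eval] using DFunLike.congr_fun this F

/-- The map `t ↦ ∑ t_i D_i` carries the `j`-th coordinate line through `t` to the line in direction
`D j`; this turns degrees in `t_j` into directional degrees. -/
theorem lineAt_eq_pullback [DecidableEq σ] (F : SymmetricAlgebra K (Module.Dual K V))
    (t : σ → K) (j : σ) :
    lineAt (∑ i, t i • D i) (D j) F =
      aeval (fun i => Polynomial.C (t i) + if i = j then Polynomial.X else 0)
        (pullback K D F) := by
  have : lineAt (∑ i, t i • D i) (D j) =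
      (aeval (fun i => Polynomial.C (t i) + if i = j then Polynomial.X else 0)).comp
        (pullback K D) := by
    ext1
    ext1 x
    suffices h : lineAt (∑ i, t i • D i) (D j) (SymmetricAlgebra.ι K _ x) =
        aeval (fun i => Polynomial.C (t i) + if i = j then Polynomial.X else 0)
          (pullback K D (SymmetricAlgebra.ι K _ x)) from h
    rw [lineAt_ι, pullback_ι, map_sum, map_sum, map_sum]
    simp [mul_add, Finset.sum_add_distrib, algHom_C, mul_comm (t _)]
  exact DFunLike.congr_fun this F

theorem degree_lineAt_lt (F : SymmetricAlgebra K (Module.Dual K V)) (t : σ → K) (j : σ) {n : ℕ}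
    (h : ∀ β ∈ (pullback K D F).support, β j < n) :
    (lineAt (∑ i, t i • D i) (D j) F).degree < n := by
  classical
  rw [lineAt_eq_pullback, aeval_def, eval₂_eq', ← Polynomial.mem_degreeLT]
  refine Submodule.sum_mem _ fun β hβ => ?_
  rw [← Polynomial.C_eq_algebraMap, ← Polynomial.smul_eq_C_mul]
  refine Submodule.smul_mem _ _ (Polynomial.mem_degreeLT.2 ?_)
  refine lt_of_le_of_lt ?_ (WithBot.coe_lt_coe.2 (h β hβ))
  refine (Polynomial.degree_prod_le _ _).trans ?_
  rw [← Finset.sum_erase_add _ _ (Finset.mem_univ j)]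
  refine add_le_of_nonpos_of_le (Finset.sum_nonpos fun i hi => ?_) ?_
  · rw [if_neg (Finset.ne_of_mem_erase hi), add_zero, ← Polynomial.C_pow]
    exact Polynomial.degree_C_le
  · refine (Polynomial.degree_pow_le _ _).trans ?_
    rw [if_pos rfl, add_comm, Polynomial.degree_X_add_C, nsmul_one]
    exact le_rfl

/-- Translating `t` by a relation does not move the point `∑ t_i D_i`. -/
theorem translate_pullback (F : SymmetricAlgebra K (Module.Dual K V)) {l : σ → K}
    (hl : l ∈ relations K D) : translate l (pullback K D F) = pullback K D F := by
  have hl' : ∑ i, l i • D i = 0 := by simpa [relations, Fintype.linearCombination_apply] using hl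
  have : (translate l).comp (pullback K D) = pullback K D := by
    ext1
    ext1 x
    have hx : ∑ i, x (D i) * l i = 0 := by
      simpa [mul_comm] using congrArg x hl'
    have hx' : ∑ i, (C (x (D i)) * C (l i) : MvPolynomial σ K) = 0 := by
      rw [← map_zero C, ← hx, map_sum]
      simp
    suffices h : translate l (pullback K D (SymmetricAlgebra.ι K _ x)) =
      pullback K D (SymmetricAlgebra.ι K _ x) from h
    rw [pullback_ι, map_sum]
    simp [translate, mul_add, Finset.sum_add_distrib, hx', algHom_C]
  exact DFunLike.congr_fun this F

variable {D}

theorem pullback_injective [Infinite K] [FiniteDimensional K V]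
    (hD : Submodule.span K (Set.range D) = ⊤) : Function.Injective (pullback K D) := by
  rw [injective_iff_map_eq_zero]
  intro F hF
  refine eq_zero_of_evalAt_eq_zero fun v => ?_
  obtain ⟨t, rfl⟩ := (Submodule.mem_span_range_iff_exists_fun K).1
    (hD ▸ Submodule.mem_top : v ∈ Submodule.span K (Set.range D))
  rw [← eval_pullback, hF, map_zero]

/-- If the `D i` span `V`, the polynomials that are invariant under translations by the
relations among the `D i` come from polynomial functions on `V`. -/
theorem exists_pullback_eq [Infinite K]
    (hD : Submodule.span K (Set.range D) = ⊤) {q : MvPolynomial σ K} {d : ℕ}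
    (hq : q.IsHomogeneous d) (hinv : ∀ l ∈ relations K D, translate l q = q) :
    ∃ F ∈ symDegree K (Module.Dual K V) d, pullback K D F = q := by
  -- For a linear section `s` of `t ↦ ∑ t_i D_i`, the required function is `F = q ∘ s`: the
  -- difference `s (∑ t_i D_i) - t` is a relation, so invariance gives `F(∑ t_i D_i) = q(t)`.
  obtain ⟨s, hs⟩ := LinearMap.exists_rightInverse_of_surjective (Fintype.linearCombination K D)
    (by rw [Fintype.range_linearCombination, hD])
  let ψ : MvPolynomial σ K →ₐ[K] SymmetricAlgebra K (Module.Dual K V) :=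
    aeval fun i => SymmetricAlgebra.ι K _ (LinearMap.proj i ∘ₗ s)
  have hψ : ∀ v, evalAt v (ψ q) = eval (s v) q := by
    intro v
    have : (evalAt v).comp ψ = (aeval (s v) : MvPolynomial σ K →ₐ[K] K) := by
      ext i
      simp [ψ]
    simpa [aeval_eq_eval] using DFunLike.congr_fun this q
  refine ⟨ψ q, ?_, MvPolynomial.funext fun t => ?_⟩
  · have hmap : (homogeneousSubmodule σ K d).map ψ.toLinearMap ≤
        symDegree K (Module.Dual K V) d := by
      rw [← homogeneousSubmodule_one_pow, Submodule.map_pow, symDegree]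
      refine pow_le_pow_left' ?_ d
      rw [homogeneousSubmodule_one_eq_span_X, Submodule.map_span, Submodule.span_le]
      rintro _ ⟨_, ⟨i, rfl⟩, rfl⟩
      exact ⟨LinearMap.proj i ∘ₗ s, by simp [ψ]⟩
    exact hmap (Submodule.mem_map_of_mem hq)
  · rw [eval_pullback, hψ]
    have hl : s (∑ i, t i • D i) - t ∈ relations K D := by
      have := LinearMap.congr_fun hs (∑ i, t i • D i)
      rw [relations, LinearMap.mem_ker, map_sub, sub_eq_zero]
      simpa [Fintype.linearCombination_apply] using this
    have h := eval_translate (s (∑ i, t i • D i) - t) t q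
    rw [hinv _ hl, add_sub_cancel] at h
    exact h.symm

theorem isHomogeneous_pullback {F : SymmetricAlgebra K (Module.Dual K V)} {d : ℕ}
    (hF : F ∈ symDegree K (Module.Dual K V) d) : (pullback K D F).IsHomogeneous d := by
  have hmap : (symDegree K (Module.Dual K V) d).map (pullback K D).toLinearMap ≤
      homogeneousSubmodule σ K d := by
    rw [symDegree, Submodule.map_pow, ← homogeneousSubmodule_one_pow]
    refine pow_le_pow_left' ?_ d
    rintro _ ⟨_, ⟨x, rfl⟩, rfl⟩
    rw [AlgHom.toLinearMap_apply, pullback_ι, mem_homogeneousSubmodule]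
    exact IsHomogeneous.sum _ _ _ fun i _ => (isHomogeneous_X K i).C_mul _
  exact hmap (Submodule.mem_map_of_mem hF)

/-- The degrees in the variables `t h` of the pullback of a combination of truncated products. -/
theorem exponent_pullback_lt {κ : Type*} {x : κ → Module.Dual K V} {b : σ → Fin 2}
    {A : Finset κ} {F : SymmetricAlgebra K (Module.Dual K V)}
    (hF : F ∈ Submodule.span K (truncatedProducts x D b A ⊤)) {β : σ →₀ ℕ}
    (hβ : β ∈ (pullback K D F).support) (h : σ) : β h < nonvanishing x A (D h) + b h := by
  classical
  have hle : Submodule.span K (truncatedProducts x D b A ⊤) ≤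
      (restrictSupport K {β | β h < nonvanishing x A (D h) + b h}).comap
        (pullback K D).toLinearMap := by
    rw [Submodule.span_le]
    rintro _ ⟨Y, hY, hb, rfl⟩
    rw [SetLike.mem_coe, Submodule.mem_comap, AlgHom.toLinearMap_apply, mem_restrictSupport_iff]
    intro β hβ
    refine lt_of_le_of_lt ?_ (nonvanishing_lt hY (hb h Submodule.mem_top))
    refine (monomial_le_degreeOf h hβ).trans ?_
    rw [map_prod]
    refine (degreeOf_prod_le _ _ _).trans ?_
    rw [nonvanishing, Finset.card_filter]
    refine Finset.sum_le_sum fun i _ => ?_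
    rw [pullback_ι]
    refine (degreeOf_sum_le _ _ _).trans (Finset.sup_le fun j _ => ?_)
    split_ifs with hx
    · exact (degreeOf_C_mul_le _ _ _).trans (by rw [degreeOf_X]; split_ifs <;> simp)
    · by_cases hj : h = j
      · rw [← hj, not_not.1 hx, C_0, zero_mul, degreeOf_zero]
      · exact (degreeOf_C_mul_le _ _ _).trans (degreeOf_X_of_ne hj).le
  exact (mem_restrictSupport_iff K).1 (hle hF) hβ

end Action

end Zonotopal

/-! ### The isomorphism -/

namespace Zonotopal

open MvPolynomial

/-- The multigraded components of the Cox-Nagata ring of the hyperplane normals of `X` are the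
homogeneous components of the spaces `P(X(a), 0, J_b)`. -/
theorem exists_linearEquiv_coxNagataDegree_pSpaceZeroDegree {K : Type*} [Field K] [CharZero K]
    {V : Type*} [AddCommGroup V] [Module K V] [FiniteDimensional K V]
    {N : ℕ} (X : Fin N → Module.Dual K V) (hX : Submodule.span K (Set.range X) = ⊤)
    -- a defining normal for every hyperplane
    (D : Hyperplane K X → V)
    (hD : ∀ H, {i | X i (D H) = 0} = H.1.1)
    (a : Fin N → ℕ) (b : Hyperplane K X → Fin 2) (d : ℕ) :
    ∃ Φ : coxNagataDegree K D d
          (nonContainment K X *ᵥ (fun i => (a i : ℤ)) - 1 + fun H => ((b H : ℕ) : ℤ))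
        ≃ₗ[K] pSpaceZeroDegree K (replicate X a)
          (upperSetReplicate K X a (upperSetOf K X b)) d,
      ∀ g, setSOne K _ g.1 =
        pullback K D (Φ g).1 := by
  set u : Hyperplane K X → ℤ :=
    nonContainment K X *ᵥ (fun i => (a i : ℤ)) - 1 + fun H => ((b H : ℕ) : ℤ) with hu
  set P := pSpaceZeroDegree K (replicate X a) (upperSetReplicate K X a (upperSetOf K X b)) d
    with hP
  -- The strict form absorbs the `- 1` in `u` and remains meaningful when `u H = -1`, where no
  -- exponent is allowed.
  have hle : ∀ (n : ℕ) (H : Hyperplane K X), (n : ℤ) ≤ u H ↔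
      n < nonvanishing (replicate X a) Finset.univ (D H) + b H := by
    intro n H
    rw [hu, Pi.add_apply, Pi.sub_apply, Pi.one_apply, ← nonvanishing_replicate X D hD a H]
    omega
  have hspan := commonKernel_le_span_normals X hX D hD
  have hDspan : Submodule.span K (Set.range D) = ⊤ := by
    rw [eq_top_iff]
    refine le_trans (fun v _ => ?_) ((hspan ∅).trans (Submodule.span_mono fun v hv => hv.1))
    simp
  have hinj : Function.Injective ((setSOne K (Hyperplane K X)).toLinearMap ∘ₗ
      (coxNagataDegree K D d u).subtype) := fun g g' h =>
    Subtype.ext (eq_of_setSOne_eq (isWeightedHomogeneous_pairWeight g.2.2)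
      (isWeightedHomogeneous_pairWeight g'.2.2) h)
  have hinj' : Function.Injective ((pullback K D).toLinearMap ∘ₗ P.subtype) :=
    (pullback_injective hDspan).comp Subtype.val_injective
  have hrange : LinearMap.range ((setSOne K (Hyperplane K X)).toLinearMap ∘ₗ
      (coxNagataDegree K D d u).subtype) =
      LinearMap.range ((pullback K D).toLinearMap ∘ₗ P.subtype) := by
    apply le_antisymm
    · rintro _ ⟨⟨g, hgG, hg⟩, rfl⟩
      have hexp := fun β hβ => exponent_setSOne (β := β) hg hβ
      have hhom : (setSOne K (Hyperplane K X) g).IsHomogeneous d := by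
        intro β hβ
        rw [← (hexp β (mem_support_iff.2 hβ)).1, Finsupp.weight_apply,
          Finsupp.sum_fintype _ _ (by simp)]
        simp
      obtain ⟨F, hFd, hF⟩ := exists_pullback_eq hDspan hhom
        ((mem_coxNagata_iff_translate D (isWeightedHomogeneous_pairWeight hg)).1 hgG)
      refine ⟨⟨F, ?_, hFd⟩, hF⟩
      rw [SetLike.mem_coe, pSpaceZero_eq_span_truncatedProducts X D hD]
      -- With `S = ∅` the common kernel is all of `V`.
      obtain ⟨Q, hQ, hFQ⟩ := exists_mem_span_truncatedProducts (replicate X a) D b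
        (fun S => by rw [commonKernel_replicate]; exact hspan _) Finset.univ ∅ F
        (fun H _ w _ => by
          obtain ⟨t, rfl⟩ := (Submodule.mem_span_range_iff_exists_fun K).1
            (hDspan ▸ Submodule.mem_top : w ∈ Submodule.span K (Set.range D))
          refine degree_lineAt_lt D F t H fun β hβ => ?_
          rw [hF] at hβ
          exact (hle _ _).1 ((hexp β hβ).2 H))
      have htop : commonKernel (replicate X a) ∅ = ⊤ := by
        ext
        simp
      rw [htop] at hQ hFQ
      have : F - Q = 0 := eq_zero_of_evalAt_eq_zero fun v => by
        rw [map_sub, hFQ v Submodule.mem_top, sub_self]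
      rwa [sub_eq_zero.1 this]
    · rintro _ ⟨⟨F, hF, hFd⟩, rfl⟩
      rw [SetLike.mem_coe, pSpaceZero_eq_span_truncatedProducts X D hD] at hF
      obtain ⟨g, hg, hgF⟩ := exists_setSOne_eq (q := pullback K D F) (d := d) (u := u)
        fun β hβ => by
          refine ⟨?_, fun H => (hle _ _).2 (exponent_pullback_lt hF hβ H)⟩
          rw [← isHomogeneous_pullback hFd (mem_support_iff.1 hβ), Finsupp.weight_apply,
            Finsupp.sum_fintype _ _ (by simp)]
          simp
      refine ⟨⟨g, ?_, hg⟩, hgF⟩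
      refine (mem_coxNagata_iff_translate D (isWeightedHomogeneous_pairWeight hg)).2
        fun l hl => ?_
      rw [hgF, translate_pullback D F hl]
  -- Both sides embed in `K[t]` with the same image; going through that image makes the isomorphism
  -- natural by construction.
  refine ⟨(LinearEquiv.ofInjective _ hinj).trans ((LinearEquiv.ofEq _ _ hrange).trans
    (LinearEquiv.ofInjective _ hinj').symm), fun g => ?_⟩
  have h := LinearEquiv.apply_symm_apply (LinearEquiv.ofInjective _ hinj')
    (LinearEquiv.ofEq _ _ hrange (LinearEquiv.ofInjective _ hinj g))
  exact (congrArg Subtype.val h).symm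

end Zonotopal

theorem mainTheorem11 {K : Type*} [Field K] [CharZero K]
    {V : Type*} [AddCommGroup V] [Module K V] [FiniteDimensional K V]
    (hr : 1 ≤ Module.finrank K V)
    {N : ℕ} (X : Fin N → Module.Dual K V) (hX : Submodule.span K (Set.range X) = ⊤)
    -- a defining normal for every hyperplane
    (D : Zonotopal.Hyperplane K X → V)
    (hD : ∀ H, {i | X i (D H) = 0} = H.1.1)
    (a : Fin N → ℕ) (b : Zonotopal.Hyperplane K X → Fin 2) (d : ℕ) :
    ∃ Φ : Zonotopal.coxNagataDegree K D d
          (Zonotopal.nonContainment K X *ᵥ (fun i => (a i : ℤ)) - 1 + fun H => ((b H : ℕ) : ℤ))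
        ≃ₗ[K] Zonotopal.pSpaceZeroDegree K (Zonotopal.replicate X a)
          (Zonotopal.upperSetReplicate K X a (Zonotopal.upperSetOf K X b)) d,
      ∀ g, Zonotopal.setSOne K _ g.1 =
        Zonotopal.pullback K D (Φ g).1 :=
  Zonotopal.exists_linearEquiv_coxNagataDegree_pSpaceZeroDegree X hX D hD a b d
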